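/- Let $S\subset\mathbb R^3$ be a closed set and let $\boldsymbol\mu=(\mu_1,\mu_2,\mu_3)\in\mathcal M(S)^3$, where $\mathcal M(S)$ denotes the space of finite signed Borel measures on $\mathbb R^3$ whose support lies in $S$. The magnetic field generated by $\boldsymbol\mu$ is, for $x\in\mathbb R^3$ outside the support of $\boldsymbol\mu$, $$\mathbf b(\boldsymbol\mu)(x)=-c\left(\int\frac{1}{|x-y|^3}\,d\boldsymbol\mu(y)-3\int (x-y)\,\frac{(x-y)\cdot d\boldsymbol\mu(y)}{|x-y|^5}\right),\qquad c=10^{-7}.$$ Call $\boldsymbol\mu$ *$S$-silent* if $\mathbf b(\boldsymbol\mu)$ vanishes on $\mathbb R^3\setminus S$, and *divergence-free* ($\operatorname{div}\boldsymbol\mu=0$) if $\sum_{i=1}^3\int\partial_{x_i}\varphi\,d\mu_i=0$ for every $\varphi\in C_c^\infty(\mathbb R^3)$. Call a closed set $S\subset\mathbb R^3$ *slender* if its Lebesgue measure is zero and each connected component of $\mathbb R^3\setminus S$ has infinite Lebesgue measure. 1. If $\operatorname{div}\boldsymbol\mu=0$, then $\boldsymbol\mu$ is $S$-silent. 2. If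 $S$ is slender and $\boldsymbol\mu$ is $S$-silent, then $\operatorname{div}\boldsymbol\mu=0$. -/

import Mathlib

open MeasureTheory
open scoped ContDiff

noncomputable section

namespace Magnetization

/-- Euclidean three-space. -/
abbrev E3 : Type := EuclideanSpace ℝ (Fin 3)

/-- `M(S)`: the finite signed Borel measures on `ℝ³` whose support lies in `S`. (A Mathlib signed
measure is automatically finite; its support is that of its total variation measure.) -/
def signedMeasuresOn (S : Set E3) : Set (SignedMeasure E3) :=
  {ν | ν.totalVariation.support ⊆ S}

/-- The partial derivative `∂ᵢ φ (y)`. -/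
def partialDeriv (i : Fin 3) (φ : E3 → ℝ) (y : E3) : ℝ :=
  fderiv ℝ φ y (EuclideanSpace.single i 1)

/-- The distributional divergence of an `ℝ³`-valued measure `μ = (μ₁, μ₂, μ₃)`, tested against `φ`:
`⟨φ, div μ⟩ = -∑ᵢ ∫ ∂ᵢφ dμᵢ`. -/
def distribDiv (μ : Fin 3 → SignedMeasure E3) (φ : E3 → ℝ) : ℝ :=
  -∑ i, ∫ᵛ y, partialDeriv i φ y ∂<•(μ i)

/-- `div μ = 0` in the sense of distributions: it vanishes on all of `C_c^∞(ℝ³)`. -/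
def IsDivergenceFree (μ : Fin 3 → SignedMeasure E3) : Prop :=
  ∀ φ : E3 → ℝ, ContDiff ℝ ∞ φ → HasCompactSupport φ → distribDiv μ φ = 0

/-- The physical constant `c = 10⁻⁷` (in henries per metre). -/
def fieldConst : ℝ := 1 / 10 ^ 7

/-- The magnetic field generated by `μ`; meaningful at points `x` outside the support of `μ`:
`b(μ)(x) = -c (∫ |x-y|⁻³ dμ(y) - 3 ∫ (x-y) ((x-y)·dμ(y)) / |x-y|⁵)`. -/
def magneticField (μ : Fin 3 → SignedMeasure E3) (x : E3) : E3 :=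
  WithLp.toLp 2 fun i =>
    -fieldConst * ((∫ᵛ y, 1 / ‖x - y‖ ^ 3 ∂<•(μ i))
      - 3 * ∑ j, ∫ᵛ y, (x - y) i * (x - y) j / ‖x - y‖ ^ 5 ∂<•(μ j))

/-- `μ` and `ν` are `S`-equivalent if their magnetic fields agree off `S`. -/
def SEquivalent (S : Set E3) (μ ν : Fin 3 → SignedMeasure E3) : Prop :=
  ∀ x ∉ S, magneticField μ x = magneticField ν x

/-- `μ` is `S`-silent if it is `S`-equivalent to the zero magnetization. -/
def IsSilent (S : Set E3) (μ : Fin 3 → SignedMeasure E3) : Prop :=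
  SEquivalent S μ 0

/-- A closed set is slender if it is Lebesgue-null and every connected component of its
complement has infinite Lebesgue measure. -/
structure IsSlender (S : Set E3) : Prop where
  isClosed : IsClosed S
  volume_eq_zero : volume S = 0
  volume_component : ∀ x ∈ Sᶜ, volume (connectedComponentIn Sᶜ x) = ⊤

/-- The field of the zero magnetization vanishes, so that `S`-silent means that the field
vanishes off `S`. -/
theorem magneticField_zero (x : E3) : magneticField 0 x = 0 := by
  ext i
  simp [magneticField]

theorem isSilent_iff (S : Set E3) (μ : Fin 3 → SignedMeasure E3) :
    IsSilent S μ ↔ ∀ x ∉ S, magneticField μ x = 0 := by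
  simp only [IsSilent, SEquivalent, magneticField_zero]

end Magnetization

end

noncomputable section

namespace Magnetization

open Filter Topology

/-! Write `lam` for the sum of the total variations, `m` for the bounded densities of μ with respect
to it, K(z) = z/|z|³, and U(x) = ∫ K(x-y)·m(y) dlam(y) for the scalar `potential`. Two facts link
field and divergence. Off S, differentiation under the integral gives b(μ) = -c ∇U
(`magneticField_apply_eq_integral`, `hasFDerivAt_potential`). On all of ℝ³, in the sense of
distributions, ΔU is `coulombFlux` times div μ (`integral_potential_mul_laplacian`); only the
positivity of that constant matters.

Divergence-free implies silent: for x off S, the i-th component of the field is, up to a constant,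
the pairing of div μ with the function y ↦ Kᵢ(x-y). Cutting this function off near x and near
infinity yields admissible test functions, and the error vanishes in the limit because μ is finite
(`integral_coulombDeriv_eq_zero`).

Silent implies divergence-free, for slender S: ∇U = 0 off S, so U is constant on each component of
the complement. U is an integrable function plus a uniformly small one, so a nonzero constant is
impossible on a set of infinite volume (`potential_eq_zero_of_const`). Thus U = 0 off the null set
S, hence almost everywhere, so ΔU = 0 and div μ = 0. -/

/-! ### Densities with respect to a common finite measure. -/

/-- Every finite family of signed measures has bounded densities with respect to a common finite
measure, which may be taken to be the sum of the total variations. -/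
theorem exists_bounded_density {X ι : Type*} [MeasurableSpace X] [Fintype ι]
    (μ : ι → SignedMeasure X) :
    ∃ m : ι → X → ℝ, (∀ i, Measurable (m i)) ∧ (∀ i x, |m i x| ≤ 1) ∧
      ∀ i (f : X → ℝ), Integrable f (∑ i, (μ i).totalVariation) →
        ∫ᵛ x, f x ∂<•(μ i) = ∫ x, f x * m i x ∂(∑ i, (μ i).totalVariation) := by
  have hfin : ∀ i, IsFiniteMeasure (μ i).totalVariation := fun i ↦ by
    rw [SignedMeasure.totalVariation]; infer_instance
  set lam := ∑ i, (μ i).totalVariation with hlam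
  have hle : ∀ i, (μ i).totalVariation ≤ lam := fun i ↦ by
    rw [hlam, Measure.le_iff]
    intro s _
    rw [Measure.finsetSum_apply]
    exact Finset.single_le_sum (f := fun i ↦ (μ i).totalVariation s) (fun _ _ ↦ zero_le)
      (Finset.mem_univ i)
  let p i := (μ i).toJordanDecomposition.posPart
  let n i := (μ i).toJordanDecomposition.negPart
  have hp : ∀ i, p i ≤ lam := fun i ↦ le_trans (Measure.le_add_right le_rfl) (hle i)
  have hn : ∀ i, n i ≤ lam := fun i ↦ le_trans (Measure.le_add_left le_rfl) (hle i)
  let d i x := ((p i).rnDeriv lam x).toReal - ((n i).rnDeriv lam x).toReal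
  have hdm : ∀ i, Measurable (d i) := fun i ↦
    (Measure.measurable_rnDeriv _ _).ennreal_toReal.sub
      (Measure.measurable_rnDeriv _ _).ennreal_toReal
  -- The Radon–Nikodym derivatives are bounded by 1 only almost everywhere; clamping makes the bound
  -- hold at every point and changes the density only on a null set.
  refine ⟨fun i x ↦ max (-1) (min 1 (d i x)), fun i ↦ ?_, fun i x ↦ ?_, fun i f hf ↦ ?_⟩
  · exact measurable_const.max (measurable_const.min (hdm i))
  · rw [abs_le]
    exact ⟨le_max_left _ _, max_le (by norm_num) (min_le_left _ _)⟩
  · have hfp : Integrable f (p i) := hf.mono_measure (hp i)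
    have hfn : Integrable f (n i) := hf.mono_measure (hn i)
    have key : ∫ᵛ x, f x ∂<•(μ i) = ∫ x, f x ∂(p i) - ∫ x, f x ∂(n i) := by
      conv_lhs => rw [← SignedMeasure.toSignedMeasure_toJordanDecomposition (μ i)]
      rw [JordanDecomposition.toSignedMeasure, VectorMeasure.integral_sub_vectorMeasure,
        VectorMeasure.integral_toSignedMeasure, VectorMeasure.integral_toSignedMeasure]
      · simpa [VectorMeasure.Integrable] using hfp
      · simpa [VectorMeasure.Integrable] using hfn
    have hpac := Measure.absolutelyContinuous_of_le (hp i)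
    have hnac := Measure.absolutelyContinuous_of_le (hn i)
    rw [key, ← integral_rnDeriv_smul hpac, ← integral_rnDeriv_smul hnac, ← integral_sub]
    · refine integral_congr_ae ?_
      filter_upwards [Measure.rnDeriv_le_one_of_le (hp i), Measure.rnDeriv_le_one_of_le (hn i)]
        with x h1 h2
      have h1' := ENNReal.toReal_mono ENNReal.one_ne_top h1
      have h2' := ENNReal.toReal_mono ENNReal.one_ne_top h2
      have h3 := ENNReal.toReal_nonneg (a := (p i).rnDeriv lam x)
      have h4 := ENNReal.toReal_nonneg (a := (n i).rnDeriv lam x)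
      simp only [ENNReal.toReal_one] at h1' h2'
      rw [min_eq_right (by simp only [d]; linarith), max_eq_right (by simp only [d]; linarith)]
      simp only [d, smul_eq_mul]
      ring
    · exact (integrable_rnDeriv_smul_iff hpac).2 hfp
    · exact (integrable_rnDeriv_smul_iff hnac).2 hfn

/-! ### The Coulomb kernel and its smooth regularisations. -/

/-- The regularised norm `√(|z|² + ε²)`. -/
def softNorm (ε : ℝ) (z : E3) : ℝ := √(‖z‖ ^ 2 + ε ^ 2)

/-- The regularised Coulomb kernel `zᵢ / (|z|² + ε²)^(3/2)`. -/
def coulomb (ε : ℝ) (i : Fin 3) (z : E3) : ℝ := z i / softNorm ε z ^ 3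

/-- The partial derivative `∂ⱼ` of `coulomb ε i`. -/
def coulombDeriv (ε : ℝ) (i j : Fin 3) (z : E3) : ℝ :=
  (if i = j then 1 else 0) / softNorm ε z ^ 3 - 3 * (z i * z j / softNorm ε z ^ 5)

@[simp] theorem softNorm_zero (z : E3) : softNorm 0 z = ‖z‖ := by simp [softNorm]

theorem norm_le_softNorm (ε : ℝ) (z : E3) : ‖z‖ ≤ softNorm ε z :=
  Real.le_sqrt_of_sq_le (by nlinarith [sq_nonneg ε])

theorem softNorm_nonneg (ε : ℝ) (z : E3) : 0 ≤ softNorm ε z := Real.sqrt_nonneg _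

theorem softNorm_pos {ε : ℝ} {z : E3} (h : ε ≠ 0 ∨ z ≠ 0) : 0 < softNorm ε z := by
  rw [softNorm, Real.sqrt_pos]
  rcases h with h | h
  · have := sq_pos_of_ne_zero h; positivity
  · have := norm_pos_iff.2 h; positivity

theorem measurable_softNorm (ε : ℝ) : Measurable (softNorm ε) := by
  unfold softNorm; fun_prop

theorem measurable_apply (i : Fin 3) : Measurable fun z : E3 ↦ z i :=
  (EuclideanSpace.proj (𝕜 := ℝ) i).continuous.measurable

theorem abs_apply_le_norm (z : E3) (i : Fin 3) : |z i| ≤ ‖z‖ := PiLp.norm_apply_le z i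

/-- The kernel is a gradient, of -1/`softNorm ε`, so its Jacobian is a symmetric Hessian. -/
theorem coulombDeriv_comm (ε : ℝ) (i j : Fin 3) (z : E3) :
    coulombDeriv ε i j z = coulombDeriv ε j i z := by
  simp only [coulombDeriv, eq_comm (a := i), mul_comm (z i)]

theorem measurable_coulomb (ε : ℝ) (i : Fin 3) : Measurable (coulomb ε i) := by
  have h := measurable_softNorm ε
  exact (measurable_apply i).div (h.pow_const 3)

theorem measurable_coulombDeriv (ε : ℝ) (i j : Fin 3) : Measurable (coulombDeriv ε i j) := by
  have h := measurable_softNorm ε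
  exact (measurable_const.div (h.pow_const 3)).sub
    ((((measurable_apply i).mul (measurable_apply j)).div (h.pow_const 5)).const_mul 3)

/-- The kernel and its regularisations are bounded by `|z|⁻²`. -/
theorem abs_coulomb_le (ε : ℝ) (i : Fin 3) (z : E3) : |coulomb ε i z| ≤ (‖z‖ ^ 2)⁻¹ := by
  rcases eq_or_ne z 0 with rfl | hz
  · simp [coulomb]
  have h0 := norm_pos_iff.2 hz
  have hq := norm_le_softNorm ε z
  rw [coulomb, abs_div, abs_of_nonneg (pow_nonneg (softNorm_nonneg ε z) 3)]
  calc |z i| / softNorm ε z ^ 3 ≤ ‖z‖ / ‖z‖ ^ 3 := by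
        gcongr; exact abs_apply_le_norm z i
    _ = (‖z‖ ^ 2)⁻¹ := by field_simp

theorem abs_coulombDeriv_le (i j : Fin 3) {r : ℝ} (hr : 0 < r) {z : E3} (hz : r ≤ ‖z‖) :
    |coulombDeriv 0 i j z| ≤ 4 / r ^ 3 := by
  have h0 : 0 < ‖z‖ := hr.trans_le hz
  have h1 : |(if i = j then (1 : ℝ) else 0) / ‖z‖ ^ 3| ≤ 1 / ‖z‖ ^ 3 := by
    rw [abs_div, abs_of_nonneg (by positivity : 0 ≤ ‖z‖ ^ 3)]
    gcongr
    split_ifs <;> simp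
  have h2 : |3 * (z i * z j / ‖z‖ ^ 5)| ≤ 3 / ‖z‖ ^ 3 := by
    rw [abs_mul, abs_div, abs_mul, abs_of_nonneg (by positivity : 0 ≤ ‖z‖ ^ 5),
      abs_of_pos (by norm_num : (0 : ℝ) < 3)]
    calc 3 * (|z i| * |z j| / ‖z‖ ^ 5) ≤ 3 * (‖z‖ * ‖z‖ / ‖z‖ ^ 5) := by
          gcongr <;> exact abs_apply_le_norm z _
      _ = 3 / ‖z‖ ^ 3 := by field_simp
  rw [coulombDeriv, softNorm_zero]
  calc _ ≤ 1 / ‖z‖ ^ 3 + 3 / ‖z‖ ^ 3 := (abs_sub _ _).trans (add_le_add h1 h2)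
    _ = 4 / ‖z‖ ^ 3 := by ring
    _ ≤ 4 / r ^ 3 := by gcongr

theorem contDiffAt_softNorm {ε : ℝ} {z : E3} (h : ε ≠ 0 ∨ z ≠ 0) :
    ContDiffAt ℝ ∞ (softNorm ε) z := by
  have := softNorm_pos h
  rw [softNorm, Real.sqrt_pos] at this
  unfold softNorm
  exact ((contDiff_norm_sq ℝ).contDiffAt.add contDiffAt_const).sqrt this.ne'

theorem contDiffAt_coulomb {ε : ℝ} (i : Fin 3) {z : E3} (h : ε ≠ 0 ∨ z ≠ 0) :
    ContDiffAt ℝ ∞ (coulomb ε i) z := by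
  unfold coulomb
  exact ContDiffAt.div (by fun_prop) ((contDiffAt_softNorm h).pow 3) (pow_pos (softNorm_pos h) 3).ne'

theorem hasFDerivAt_coulomb {ε : ℝ} (i : Fin 3) {z : E3} (h : ε ≠ 0 ∨ z ≠ 0) :
    HasFDerivAt (coulomb ε i)
      (∑ j, coulombDeriv ε i j z • EuclideanSpace.proj (𝕜 := ℝ) j) z := by
  have hq := softNorm_pos h
  have hq' := hq
  rw [softNorm, Real.sqrt_pos] at hq'
  have h1 : HasFDerivAt (softNorm ε) _ z :=
    ((hasStrictFDerivAt_norm_sq z).hasFDerivAt.add_const (ε ^ 2)).sqrt hq'.ne'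
  have h2 : HasFDerivAt (fun z : E3 ↦ z i) (EuclideanSpace.proj (𝕜 := ℝ) i) z :=
    (EuclideanSpace.proj (𝕜 := ℝ) i).hasFDerivAt
  have h3 := h2.mul ((hasDerivAt_inv (pow_pos hq 3).ne').comp_hasFDerivAt z (h1.pow 3))
  refine h3.congr_fderiv ?_
  ext v
  have hin : inner ℝ z v = ∑ j, z j * v j := by
    simp [PiLp.inner_apply, mul_comm]
  change _ = (∑ j, coulombDeriv ε i j z • EuclideanSpace.proj (𝕜 := ℝ) j) v
  have hr : (∑ j, coulombDeriv ε i j z • EuclideanSpace.proj (𝕜 := ℝ) j) v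
      = v i / softNorm ε z ^ 3 - 3 * z i / softNorm ε z ^ 5 * ∑ j, z j * v j := by
    simp only [sum_apply, smul_apply,
      PiLp.proj_apply, smul_eq_mul, coulombDeriv, sub_mul, Finset.sum_sub_distrib,
      Finset.mul_sum, ite_div, zero_div, ite_mul, zero_mul, Finset.sum_ite_eq, Finset.mem_univ,
      if_true]
    congr 1
    · ring
    · exact Finset.sum_congr rfl fun j _ ↦ by ring
  rw [hr, ← hin]
  simp only [add_apply, smul_apply, smul_eq_mul,
    PiLp.proj_apply, innerSL_apply_apply, Function.comp_apply, nsmul_eq_mul]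
  rw [show √(‖z‖ ^ 2 + ε ^ 2) = softNorm ε z from rfl]
  push_cast
  field_simp
  ring

theorem partialDeriv_coulomb {ε : ℝ} (i j : Fin 3) {z : E3} (h : ε ≠ 0 ∨ z ≠ 0) :
    partialDeriv j (coulomb ε i) z = coulombDeriv ε i j z := by
  rw [partialDeriv, (hasFDerivAt_coulomb i h).fderiv]
  simp [sum_apply]

/-! ### The Laplacian, and integration by parts against the regularised kernel. -/

/-- The Laplacian `∑ᵢ ∂ᵢ∂ᵢ φ`. -/
def laplacian (φ : E3 → ℝ) (x : E3) : ℝ := ∑ i, partialDeriv i (partialDeriv i φ) x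

theorem contDiff_partialDeriv {φ : E3 → ℝ} (hφ : ContDiff ℝ ∞ φ) (i : Fin 3) :
    ContDiff ℝ ∞ (partialDeriv i φ) :=
  (hφ.fderiv_right (by simp)).clm_apply contDiff_const

theorem hasCompactSupport_partialDeriv {φ : E3 → ℝ} (hφ : HasCompactSupport φ) (i : Fin 3) :
    HasCompactSupport (partialDeriv i φ) :=
  hφ.fderiv_apply (𝕜 := ℝ) _

theorem contDiff_laplacian {φ : E3 → ℝ} (hφ : ContDiff ℝ ∞ φ) : ContDiff ℝ ∞ (laplacian φ) :=
  ContDiff.sum fun i _ ↦ contDiff_partialDeriv (contDiff_partialDeriv hφ i) i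

theorem hasCompactSupport_laplacian {φ : E3 → ℝ} (hφ : HasCompactSupport φ) :
    HasCompactSupport (laplacian φ) := by
  have h : laplacian φ = partialDeriv 0 (partialDeriv 0 φ) + partialDeriv 1 (partialDeriv 1 φ)
      + partialDeriv 2 (partialDeriv 2 φ) := by
    ext x; simp [laplacian, Fin.sum_univ_three]
  have h' i := hasCompactSupport_partialDeriv (hasCompactSupport_partialDeriv hφ i) i
  rw [h]
  exact ((h' 0).add (h' 1)).add (h' 2)

theorem partialDeriv_comm {φ : E3 → ℝ} (hφ : ContDiff ℝ ∞ φ) (i j : Fin 3) :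
    partialDeriv i (partialDeriv j φ) = partialDeriv j (partialDeriv i φ) := by
  have h (i j : Fin 3) (x : E3) : partialDeriv i (partialDeriv j φ) x
      = fderiv ℝ (fderiv ℝ φ) x (EuclideanSpace.single i 1) (EuclideanSpace.single j 1) := by
    have hd : DifferentiableAt ℝ (fderiv ℝ φ) x :=
      ((hφ.fderiv_right (m := ∞) (by simp)).differentiable (by simp)).differentiableAt
    change fderiv ℝ (fun y ↦ fderiv ℝ φ y (EuclideanSpace.single j 1)) x _ = _
    rw [fderiv_clm_apply hd (differentiableAt_const _)]
    simp
  ext x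
  rw [h, h]
  exact (hφ.contDiffAt.isSymmSndFDerivAt (by simpa using WithTop.coe_le_coe.2 (le_top : (2 : ℕ∞) ≤ ⊤))) _ _

theorem partialDeriv_comp_add_right (φ : E3 → ℝ) (i : Fin 3) (y : E3) :
    partialDeriv i (fun x ↦ φ (x + y)) = fun x ↦ partialDeriv i φ (x + y) := by
  ext x
  rw [partialDeriv, fderiv_comp_add_right, partialDeriv]

/-- Integration by parts against a compactly supported function. -/
theorem integral_mul_partialDeriv {u g : E3 → ℝ} (hu : ContDiff ℝ ∞ u) (hg : ContDiff ℝ ∞ g)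
    (hgs : HasCompactSupport g) (j : Fin 3) :
    ∫ x, u x * partialDeriv j g x = -∫ x, partialDeriv j u x * g x := by
  refine integral_mul_fderiv_eq_neg_fderiv_mul_of_integrable ?_ ?_ ?_
    (fun x _ ↦ hu.contDiffAt.differentiableAt (by simp))
    (fun x _ ↦ hg.contDiffAt.differentiableAt (by simp))
  · exact (((contDiff_partialDeriv hu j).continuous).mul hg.continuous).integrable_of_hasCompactSupport
      hgs.mul_left
  · exact (hu.continuous.mul (contDiff_partialDeriv hg j).continuous).integrable_of_hasCompactSupport
      (hasCompactSupport_partialDeriv hgs j).mul_left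
  · exact (hu.continuous.mul hg.continuous).integrable_of_hasCompactSupport hgs.mul_left

theorem contDiff_coulomb {ε : ℝ} (hε : ε ≠ 0) (i : Fin 3) : ContDiff ℝ ∞ (coulomb ε i) :=
  contDiff_iff_contDiffAt.2 fun _ ↦ contDiffAt_coulomb i (.inl hε)

theorem integral_coulomb_mul_partialDeriv {ε : ℝ} (hε : ε ≠ 0) {g : E3 → ℝ}
    (hg : ContDiff ℝ ∞ g) (hgs : HasCompactSupport g) (i j : Fin 3) :
    ∫ x, coulomb ε i x * partialDeriv j g x = -∫ x, coulombDeriv ε i j x * g x := by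
  rw [integral_mul_partialDeriv (contDiff_coulomb hε i) hg hgs]
  simp only [partialDeriv_coulomb _ _ (.inl hε)]

/-- With s = `softNorm ε x`, the trace is 3/s³ - 3|x|²/s⁵, and s² - |x|² = ε². This concentrates at
the origin as ε → 0. -/
theorem sum_coulombDeriv_self {ε : ℝ} (hε : ε ≠ 0) (x : E3) :
    ∑ i, coulombDeriv ε i i x = 3 * ε ^ 2 / softNorm ε x ^ 5 := by
  have hq := softNorm_pos (z := x) (.inl hε)
  have hq2 : softNorm ε x ^ 2 = ‖x‖ ^ 2 + ε ^ 2 := Real.sq_sqrt (by positivity)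
  have hn : ‖x‖ ^ 2 = x 0 * x 0 + x 1 * x 1 + x 2 * x 2 := by
    rw [EuclideanSpace.norm_sq_eq, Fin.sum_univ_three]
    simp [sq]
  simp only [coulombDeriv, if_true, Fin.sum_univ_three]
  field_simp
  rw [hq2, hn]
  ring

/-- The regularised kernel inverts the Laplacian up to an approximate identity. -/
theorem integral_coulomb_mul_laplacian_of_ne_zero {ε : ℝ} (hε : ε ≠ 0) {φ : E3 → ℝ}
    (hφ : ContDiff ℝ ∞ φ) (hs : HasCompactSupport φ) (j : Fin 3) :
    ∫ x, coulomb ε j x * laplacian φ x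
      = -∫ x, 3 * ε ^ 2 / softNorm ε x ^ 5 * partialDeriv j φ x := by
  have hd i := contDiff_partialDeriv hφ i
  have hds i := hasCompactSupport_partialDeriv hs i
  have hc i := (contDiff_coulomb hε i).continuous
  have hdc i : Continuous (coulombDeriv ε i i) := by
    have := (contDiff_partialDeriv (contDiff_coulomb hε i) i).continuous
    rwa [show partialDeriv i (coulomb ε i) = coulombDeriv ε i i from
      funext fun x ↦ partialDeriv_coulomb i i (.inl hε)] at this
  -- Two integrations by parts, with the symmetry of the Jacobian in between, exchange ∂ᵢKⱼ for
  -- ∂ⱼKᵢ; summing over i then produces the divergence of the kernel.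
  have key i : ∫ x, coulomb ε j x * partialDeriv i (partialDeriv i φ) x
      = -∫ x, coulombDeriv ε i i x * partialDeriv j φ x := by
    rw [integral_coulomb_mul_partialDeriv hε (hd i) (hds i)]
    simp only [coulombDeriv_comm ε j i]
    rw [← integral_coulomb_mul_partialDeriv hε (hd i) (hds i), partialDeriv_comm hφ j i,
      integral_coulomb_mul_partialDeriv hε (hd j) (hds j)]
  simp only [laplacian, Finset.mul_sum, ← sum_coulombDeriv_self hε, Finset.sum_mul]
  rw [integral_finsetSum, integral_finsetSum]
  · simp only [key, Finset.sum_neg_distrib]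
  · exact fun i _ ↦ ((hdc i).mul (hd j).continuous).integrable_of_hasCompactSupport (hds j).mul_left
  · exact fun i _ ↦ ((hc j).mul (contDiff_partialDeriv (hd i) i).continuous).integrable_of_hasCompactSupport
      (hasCompactSupport_partialDeriv (hds i) i).mul_left

/-! ### Removing the regularisation: the limit ε → 0. -/

theorem locallyIntegrable_inv_norm_sq : LocallyIntegrable (fun z : E3 ↦ (‖z‖ ^ 2)⁻¹) := by
  refine locallyIntegrable_of_norm_le_rpow (C := 1) (α := 2) (by simp) (by simp; norm_num)
    (Eventually.of_forall fun z ↦ ?_) (by fun_prop)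
  rw [Real.rpow_neg (norm_nonneg z), Real.rpow_two, norm_inv, norm_pow, norm_norm, one_mul]

/-- The bound |x|⁻² is uniform in ε and locally integrable in dimension three, which allows
dominated convergence. -/
theorem tendsto_integral_coulomb {ψ : E3 → ℝ} (hψ : Continuous ψ) (hs : HasCompactSupport ψ)
    (j : Fin 3) :
    Tendsto (fun ε ↦ ∫ x, coulomb ε j x * ψ x) (𝓝[>] 0) (𝓝 (∫ x, coulomb 0 j x * ψ x)) := by
  refine tendsto_integral_filter_of_dominated_convergence (fun x ↦ (‖x‖ ^ 2)⁻¹ * |ψ x|) ?_ ?_ ?_ ?_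
  · exact Eventually.of_forall fun ε ↦
      ((measurable_coulomb ε j).mul hψ.measurable).aestronglyMeasurable
  · refine Eventually.of_forall fun ε ↦ Eventually.of_forall fun x ↦ ?_
    rw [Real.norm_eq_abs, abs_mul]
    gcongr
    exact abs_coulomb_le ε j x
  · exact locallyIntegrable_inv_norm_sq.integrable_smul_right_of_hasCompactSupport hψ.abs hs.abs
  · have h0 : ∀ᵐ x : E3, x ≠ 0 := by simp [ae_iff]
    filter_upwards [h0] with x hx
    have hc : ContinuousAt (fun ε ↦ coulomb ε j x * ψ x) 0 := by
      have : Continuous fun ε ↦ softNorm ε x := by unfold softNorm; fun_prop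
      have hne : softNorm 0 x ^ 3 ≠ 0 := (pow_pos (softNorm_pos (.inr hx)) 3).ne'
      exact (continuousAt_const.div (this.continuousAt.pow 3) hne).mul continuousAt_const
    exact hc.tendsto.mono_left nhdsWithin_le_nhds

theorem integrable_inv_softNorm_one : Integrable fun w : E3 ↦ 3 / softNorm 1 w ^ 5 := by
  -- Decay of order 5 exceeds the dimension 3.
  have h := (integrable_rpow_neg_one_add_norm_sq (E := E3) (μ := volume) (r := 5)
    (by simp; norm_num)).const_mul 3
  refine h.congr (Eventually.of_forall fun w ↦ ?_)
  have h1 : (0 : ℝ) ≤ 1 + ‖w‖ ^ 2 := by positivity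
  simp only [softNorm, one_pow, add_comm (‖w‖ ^ 2)]
  rw [Real.sqrt_eq_rpow, ← Real.rpow_natCast (_ ^ (1 / 2 : ℝ)), ← Real.rpow_mul h1, div_eq_mul_inv 3,
    ← Real.rpow_neg h1]
  norm_num

/-- The flux of the Coulomb field through a sphere. -/
def coulombFlux : ℝ := ∫ w : E3, 3 / softNorm 1 w ^ 5

theorem coulombFlux_pos : 0 < coulombFlux := by
  refine (integral_pos_iff_support_of_nonneg (fun w ↦ ?_) integrable_inv_softNorm_one).2 ?_
  · exact div_nonneg (by norm_num) (pow_nonneg (softNorm_nonneg _ _) 5)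
  · have : Function.support (fun w : E3 ↦ 3 / softNorm 1 w ^ 5) = Set.univ := by
      ext w
      have := softNorm_pos (z := w) (.inl one_ne_zero)
      simp [this.ne']
    rw [this]
    simp

theorem tendsto_integral_approximate_identity {h : E3 → ℝ} (hh : Continuous h)
    (hs : HasCompactSupport h) :
    Tendsto (fun ε ↦ ∫ x, 3 * ε ^ 2 / softNorm ε x ^ 5 * h x) (𝓝[>] 0)
      (𝓝 (coulombFlux * h 0)) := by
  -- Substituting x = εw, the Jacobian ε³ cancels the ε²/ε⁵ of the kernel, so all dependence on ε
  -- moves into the argument of `h`.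
  have hscale : ∀ᶠ ε : ℝ in 𝓝[>] 0, ∫ w, 3 / softNorm 1 w ^ 5 * h (ε • w)
      = ∫ x, 3 * ε ^ 2 / softNorm ε x ^ 5 * h x := by
    filter_upwards [self_mem_nhdsWithin] with ε hε
    rw [Set.mem_Ioi] at hε
    have hq (w : E3) : softNorm ε (ε • w) = ε * softNorm 1 w := by
      rw [softNorm, softNorm, norm_smul, Real.norm_of_nonneg hε.le,
        show (ε * ‖w‖) ^ 2 + ε ^ 2 = ε ^ 2 * (‖w‖ ^ 2 + 1 ^ 2) by ring,
        Real.sqrt_mul (sq_nonneg ε), Real.sqrt_sq hε.le]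
    have hc := Measure.integral_comp_smul (volume : Measure E3)
      (fun x ↦ 3 * ε ^ 2 / softNorm ε x ^ 5 * h x) ε
    simp only [finrank_euclideanSpace, Fintype.card_fin, hq, smul_eq_mul] at hc
    rw [abs_of_pos (by positivity), eq_comm, inv_mul_eq_iff_eq_mul₀ (by positivity)] at hc
    rw [hc, ← integral_const_mul]
    refine integral_congr_ae (Eventually.of_forall fun w ↦ ?_)
    have := softNorm_pos (z := w) (.inl one_ne_zero)
    simp only
    field_simp
  refine Tendsto.congr' hscale ?_
  obtain ⟨C, hC⟩ := hs.exists_bound_of_continuous hh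
  rw [coulombFlux, ← integral_mul_const]
  refine tendsto_integral_filter_of_dominated_convergence (fun w ↦ 3 / softNorm 1 w ^ 5 * C)
    ?_ ?_ (integrable_inv_softNorm_one.mul_const C) ?_
  · exact Eventually.of_forall fun ε ↦
      integrable_inv_softNorm_one.aestronglyMeasurable.mul (by fun_prop)
  · refine Eventually.of_forall fun ε ↦ Eventually.of_forall fun w ↦ ?_
    have := softNorm_pos (z := w) (.inl one_ne_zero)
    rw [norm_mul, Real.norm_of_nonneg (by positivity)]
    gcongr
    exact hC _
  · refine Eventually.of_forall fun w ↦ ?_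
    have hc : ContinuousAt (fun ε : ℝ ↦ 3 / softNorm 1 w ^ 5 * h (ε • w)) 0 := by fun_prop
    simpa using hc.tendsto.mono_left nhdsWithin_le_nhds

/-- The Coulomb kernel is, up to a constant, the gradient of the fundamental solution of the
Laplacian. -/
theorem integral_coulomb_mul_laplacian {φ : E3 → ℝ} (hφ : ContDiff ℝ ∞ φ)
    (hs : HasCompactSupport φ) (j : Fin 3) (y : E3) :
    ∫ x, coulomb 0 j (x - y) * laplacian φ x = -(coulombFlux * partialDeriv j φ y) := by
  -- The case y = 0, where both sides are limits of the regularised identity; the general case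
  -- follows by translating φ.
  have h0 {f : E3 → ℝ} (hf : ContDiff ℝ ∞ f) (hfs : HasCompactSupport f) :
      ∫ x, coulomb 0 j x * laplacian f x = -(coulombFlux * partialDeriv j f 0) := by
    refine tendsto_nhds_unique (tendsto_integral_coulomb (contDiff_laplacian hf).continuous
      (hasCompactSupport_laplacian hfs) j) ?_
    refine (tendsto_integral_approximate_identity (contDiff_partialDeriv hf j).continuous
      (hasCompactSupport_partialDeriv hfs j)).neg.congr' ?_
    filter_upwards [self_mem_nhdsWithin] with ε hε
    exact (integral_coulomb_mul_laplacian_of_ne_zero (Set.mem_Ioi.1 hε).ne' hf hfs j).symm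
  have h1 := h0 (f := fun x ↦ φ (x + y)) (hφ.comp (contDiff_id.add contDiff_const))
    (hs.comp_homeomorph (Homeomorph.addRight y))
  simp only [laplacian, partialDeriv_comp_add_right, zero_add] at h1
  rw [← h1, ← integral_add_right_eq_self _ y]
  simp [laplacian]

/-! ### The scalar potential: gradient, size on large sets, and distributional Laplacian. -/

section Potential

variable {lam : Measure E3} {m : Fin 3 → E3 → ℝ} {S : Set E3}

/-- The scalar magnetic potential of the vector measure with density `m` with respect to `lam`. -/
def potential (lam : Measure E3) (m : Fin 3 → E3 → ℝ) (x : E3) : ℝ :=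
  ∫ y, ∑ j, coulomb 0 j (x - y) * m j y ∂lam

/-- Halving the distance d from x₀ to S, one radius serves both as the size of the neighbourhood and
as the lower bound, as needed to differentiate under the integral. -/
theorem exists_le_norm_sub (hS : IsClosed S) (hlam : lam Sᶜ = 0) {x₀ : E3} (hx : x₀ ∉ S) :
    ∃ r > 0, ∀ᵐ y ∂lam, ∀ x ∈ Metric.ball x₀ r, r ≤ ‖x - y‖ := by
  obtain ⟨d, hd, hdS⟩ := Metric.isOpen_iff.1 hS.isOpen_compl x₀ hx
  refine ⟨d / 2, by positivity, ?_⟩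
  have hae : ∀ᵐ y ∂lam, y ∈ S := hlam
  filter_upwards [hae] with y hy x hxb
  have h1 : d ≤ dist y x₀ := not_lt.1 fun h ↦ hdS (Metric.mem_ball.2 h) hy
  have h2 := Metric.mem_ball.1 hxb
  have h3 := dist_triangle y x x₀
  rw [← dist_eq_norm, dist_comm]
  linarith

theorem ae_le_norm_sub (hS : IsClosed S) (hlam : lam Sᶜ = 0) {x : E3} (hx : x ∉ S) :
    ∃ r > 0, ∀ᵐ y ∂lam, r ≤ ‖x - y‖ := by
  obtain ⟨r, hr, h⟩ := exists_le_norm_sub hS hlam hx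
  exact ⟨r, hr, h.mono fun y hy ↦ hy x (Metric.mem_ball_self hr)⟩

theorem abs_coulomb_le_of_le (i : Fin 3) {r : ℝ} (hr : 0 < r) {z : E3} (hz : r ≤ ‖z‖) :
    |coulomb 0 i z| ≤ (r ^ 2)⁻¹ :=
  (abs_coulomb_le 0 i z).trans (by gcongr)

theorem integrable_coulombDeriv_mul [IsFiniteMeasure lam] (hS : IsClosed S) (hlam : lam Sᶜ = 0)
    (hm : ∀ j, Measurable (m j)) (hb : ∀ j y, |m j y| ≤ 1) {x : E3} (hx : x ∉ S) (i j : Fin 3) :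
    Integrable (fun y ↦ coulombDeriv 0 i j (x - y) * m j y) lam := by
  obtain ⟨r, hr, h⟩ := ae_le_norm_sub hS hlam hx
  refine Integrable.of_bound (((measurable_coulombDeriv 0 i j).comp
    (measurable_const.sub measurable_id)).mul (hm j)).aestronglyMeasurable (4 / r ^ 3 * 1) ?_
  filter_upwards [h] with y hy
  rw [Real.norm_eq_abs, abs_mul]
  exact mul_le_mul (abs_coulombDeriv_le i j hr hy) (hb j y) (abs_nonneg _) (by positivity)

theorem integrable_coulomb_mul [IsFiniteMeasure lam] (hS : IsClosed S) (hlam : lam Sᶜ = 0)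
    (hm : ∀ j, Measurable (m j)) (hb : ∀ j y, |m j y| ≤ 1) {x : E3} (hx : x ∉ S) (j : Fin 3) :
    Integrable (fun y ↦ coulomb 0 j (x - y) * m j y) lam := by
  obtain ⟨r, hr, h⟩ := ae_le_norm_sub hS hlam hx
  refine Integrable.of_bound (((measurable_coulomb 0 j).comp
    (measurable_const.sub measurable_id)).mul (hm j)).aestronglyMeasurable ((r ^ 2)⁻¹ * 1) ?_
  filter_upwards [h] with y hy
  rw [Real.norm_eq_abs, abs_mul]
  exact mul_le_mul (abs_coulomb_le_of_le j hr hy) (hb j y) (abs_nonneg _) (by positivity)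

/-- Near x₀ the kernel derivatives are bounded uniformly for almost every y, and `lam` is finite, so
differentiation under the integral is legitimate. The symmetry of the Jacobian puts the coefficients
in the form in which they occur in the field. -/
theorem hasFDerivAt_potential [IsFiniteMeasure lam] (hS : IsClosed S) (hlam : lam Sᶜ = 0)
    (hm : ∀ j, Measurable (m j)) (hb : ∀ j y, |m j y| ≤ 1) {x₀ : E3} (hx : x₀ ∉ S) :
    HasFDerivAt (potential lam m)
      (∑ i, (∫ y, ∑ j, coulombDeriv 0 i j (x₀ - y) * m j y ∂lam) •
        (EuclideanSpace.proj i : E3 →L[ℝ] ℝ)) x₀ := by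
  obtain ⟨r, hr, h⟩ := exists_le_norm_sub hS hlam hx
  have hF' (i : Fin 3) : Integrable (fun y ↦ (∑ j, coulombDeriv 0 i j (x₀ - y) * m j y) •
      (EuclideanSpace.proj i : E3 →L[ℝ] ℝ)) lam :=
    (integrable_finsetSum _ fun j _ ↦
      integrable_coulombDeriv_mul hS hlam hm hb hx i j).smul_const _
  have hproj (i : Fin 3) : ‖(EuclideanSpace.proj i : E3 →L[ℝ] ℝ)‖ ≤ 1 :=
    ContinuousLinearMap.opNorm_le_bound _ zero_le_one fun v ↦ by
      rw [one_mul]; exact PiLp.norm_apply_le v i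
  have hmain := hasFDerivAt_integral_of_dominated_of_fderiv_le (μ := lam) (𝕜 := ℝ)
    (F := fun x y ↦ ∑ j, coulomb 0 j (x - y) * m j y)
    (F' := fun x y ↦ ∑ i, (∑ j, coulombDeriv 0 i j (x - y) * m j y) •
      (EuclideanSpace.proj i : E3 →L[ℝ] ℝ))
    (bound := fun _ ↦ ∑ _i : Fin 3, (∑ _j : Fin 3, 4 / r ^ 3 * 1) * 1)
    (Metric.ball_mem_nhds x₀ hr) ?_ ?_ ?_ ?_ (integrable_const _) ?_
  · refine hmain.congr_fderiv ?_
    rw [integral_finsetSum]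
    · simp only [integral_smul_const]
    · exact fun i _ ↦ hF' i
  · refine Eventually.of_forall fun x ↦ Measurable.aestronglyMeasurable ?_
    exact Finset.measurable_fun_sum _ fun j _ ↦
      ((measurable_coulomb 0 j).comp (measurable_const.sub measurable_id)).mul (hm j)
  · exact integrable_finsetSum _ fun j _ ↦ integrable_coulomb_mul hS hlam hm hb hx j
  · exact Finset.aestronglyMeasurable_fun_sum _ fun i _ ↦ (hF' i).aestronglyMeasurable
  · filter_upwards [h] with y hy x hxb
    refine norm_sum_le_of_le _ fun i _ ↦ ?_
    rw [norm_smul]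
    refine mul_le_mul (norm_sum_le_of_le _ fun j _ ↦ ?_) (hproj i) (norm_nonneg _) (by positivity)
    rw [norm_mul]
    exact mul_le_mul (abs_coulombDeriv_le i j hr (hy x hxb)) (hb j y) (norm_nonneg _)
      (by positivity)
  · filter_upwards [h] with y hy x hxb
    have hne : x - y ≠ 0 := norm_pos_iff.1 (hr.trans_le (hy x hxb))
    have hj (j : Fin 3) : HasFDerivAt (fun x ↦ coulomb 0 j (x - y) * m j y)
        (m j y • ∑ i, coulombDeriv 0 j i (x - y) • (EuclideanSpace.proj i : E3 →L[ℝ] ℝ)) x := by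
      have := (hasFDerivAt_coulomb (ε := 0) j (.inr hne)).comp x ((hasFDerivAt_id x).sub_const y)
      exact this.mul_const (m j y)
    refine (HasFDerivAt.fun_sum fun j _ ↦ hj j).congr_fderiv ?_
    simp only [Finset.smul_sum, Finset.sum_smul, smul_smul]
    rw [Finset.sum_comm]
    refine Finset.sum_congr rfl fun i _ ↦ Finset.sum_congr rfl fun j _ ↦ ?_
    rw [coulombDeriv_comm 0 i j, mul_comm]

/-- The part of the Coulomb kernel near its singularity. -/
def coulombNear (R : ℝ) (j : Fin 3) : E3 → ℝ := (Metric.ball 0 R).indicator (coulomb 0 j)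

/-- The part of the Coulomb kernel away from its singularity. -/
def coulombFar (R : ℝ) (j : Fin 3) : E3 → ℝ := (Metric.ball 0 R)ᶜ.indicator (coulomb 0 j)

theorem coulombNear_add_coulombFar (R : ℝ) (j : Fin 3) (z : E3) :
    coulombNear R j z + coulombFar R j z = coulomb 0 j z :=
  Set.indicator_self_add_compl_apply _ _ _

theorem abs_coulombFar_le {R : ℝ} (hR : 0 < R) (j : Fin 3) (z : E3) :
    |coulombFar R j z| ≤ (R ^ 2)⁻¹ := by
  by_cases hz : z ∈ Metric.ball (0 : E3) R
  · rw [coulombFar, Set.indicator_of_notMem (by simpa using hz), abs_zero]; positivity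
  · rw [coulombFar, Set.indicator_of_mem hz]
    exact abs_coulomb_le_of_le j hR (by simpa using hz)

theorem measurable_coulombFar (R : ℝ) (j : Fin 3) : Measurable (coulombFar R j) :=
  (measurable_coulomb 0 j).indicator measurableSet_ball.compl

theorem integrable_coulombNear (R : ℝ) (j : Fin 3) : Integrable (coulombNear R j) := by
  rw [coulombNear, integrable_indicator_iff measurableSet_ball]
  have h := (locallyIntegrable_inv_norm_sq.integrableOn_isCompact
    (isCompact_closedBall (0 : E3) R)).mono_set Metric.ball_subset_closedBall
  exact Integrable.mono' h (measurable_coulomb 0 j).aestronglyMeasurable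
    (Eventually.of_forall fun z ↦ abs_coulomb_le 0 j z)

theorem integrable_coulombNear_prod [IsFiniteMeasure lam] (hm : ∀ j, Measurable (m j))
    (hb : ∀ j y, |m j y| ≤ 1) (R : ℝ) (j : Fin 3) :
    Integrable (fun p : E3 × E3 ↦ coulombNear R j (p.1 - p.2) * m j p.2)
      (volume.prod lam) := by
  have h1 : Integrable (m j) lam :=
    Integrable.of_bound (hm j).aestronglyMeasurable 1 (Eventually.of_forall (hb j))
  have := h1.convolution_integrand (ContinuousLinearMap.mul ℝ ℝ) (integrable_coulombNear R j)
  simpa [mul_comm] using this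

/-- A potential that is constant on a set of infinite volume off the support vanishes there. -/
theorem potential_eq_zero_of_const [IsFiniteMeasure lam] (hS : IsClosed S) (hlam : lam Sᶜ = 0)
    (hm : ∀ j, Measurable (m j)) (hb : ∀ j y, |m j y| ≤ 1) {C : Set E3} (hC : C ⊆ Sᶜ)
    (hvol : volume C = ⊤) {a : ℝ} (ha : ∀ x ∈ C, potential lam m x = a) : a = 0 := by
  by_contra hne
  have ha0 : 0 < |a| := abs_pos.2 hne
  have hlim : Tendsto (fun R : ℝ ↦ (∑ _j : Fin 3, (R ^ 2)⁻¹ * 1) * lam.real Set.univ) atTop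
      (𝓝 0) := by
    have h1 : Tendsto (fun R : ℝ ↦ (R ^ 2)⁻¹) atTop (𝓝 0) :=
      tendsto_inv_atTop_zero.comp (tendsto_pow_atTop two_ne_zero)
    have h2 := (tendsto_finsetSum Finset.univ fun (_ : Fin 3) _ ↦ h1.mul_const (1 : ℝ)).mul_const
      (lam.real Set.univ)
    simpa using h2
  -- R is so large that the far part of the potential stays below |a|/2 everywhere.
  obtain ⟨R, hRa, hR⟩ := ((hlim.eventually (gt_mem_nhds (half_pos ha0))).and
    (eventually_gt_atTop 0)).exists
  set N : E3 → ℝ := fun x ↦ ∫ y, ∑ j, coulombNear R j (x - y) * m j y ∂lam with hN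
  have hNint : Integrable N := by
    have : Integrable (fun p : E3 × E3 ↦ ∑ j, coulombNear R j (p.1 - p.2) * m j p.2)
        (volume.prod lam) :=
      integrable_finsetSum _ fun j _ ↦ integrable_coulombNear_prod hm hb R j
    exact this.integral_prod_left
  -- By Markov's inequality the near part reaches |a|/2 in absolute value only on a set of finite
  -- volume, yet it must do so on all of `C`.
  have hlt := hNint.measure_norm_ge_lt_top (half_pos ha0)
  refine absurd (measure_mono_top (fun x hx ↦ ?_) hvol) hlt.ne
  have hfarb (j : Fin 3) (y : E3) : ‖coulombFar R j (x - y) * m j y‖ ≤ (R ^ 2)⁻¹ * 1 := by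
    rw [norm_mul]
    exact mul_le_mul (abs_coulombFar_le hR j _) (hb j y) (norm_nonneg _) (by positivity)
  have hfar (j : Fin 3) : Integrable (fun y ↦ coulombFar R j (x - y) * m j y) lam :=
    Integrable.of_bound (((measurable_coulombFar R j).comp
      (measurable_const.sub measurable_id)).mul (hm j)).aestronglyMeasurable ((R ^ 2)⁻¹ * 1)
      (Eventually.of_forall (hfarb j))
  have hnear (j : Fin 3) : Integrable (fun y ↦ coulombNear R j (x - y) * m j y) lam := by
    refine ((integrable_coulomb_mul hS hlam hm hb (hC hx) j).sub (hfar j)).congr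
      (Eventually.of_forall fun y ↦ ?_)
    simp only [Pi.sub_apply, ← coulombNear_add_coulombFar R j (x - y)]
    ring
  have hsplit : potential lam m x = N x + ∫ y, ∑ j, coulombFar R j (x - y) * m j y ∂lam := by
    rw [potential, hN, ← integral_add (integrable_finsetSum _ fun j _ ↦ hnear j)
      (integrable_finsetSum _ fun j _ ↦ hfar j)]
    simp only [← Finset.sum_add_distrib, ← add_mul, coulombNear_add_coulombFar]
  have hF : ‖∫ y, ∑ j, coulombFar R j (x - y) * m j y ∂lam‖
      ≤ (∑ _j : Fin 3, (R ^ 2)⁻¹ * 1) * lam.real Set.univ :=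
    norm_integral_le_of_norm_le_const (Eventually.of_forall fun y ↦
      norm_sum_le_of_le _ fun j _ ↦ hfarb j y)
  rw [ha x hx] at hsplit
  have h3 : |a| ≤ |N x| + |∫ y, ∑ j, coulombFar R j (x - y) * m j y ∂lam| := by
    rw [hsplit]; exact abs_add_le _ _
  rw [Real.norm_eq_abs] at hF
  change |a| / 2 ≤ ‖N x‖
  rw [Real.norm_eq_abs]
  linarith

/-- Justifies Fubini: the near part of the kernel is integrable and ψ bounded, while the far part is
bounded and ψ integrable. -/
theorem integrable_coulomb_prod [IsFiniteMeasure lam] (hm : ∀ j, Measurable (m j))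
    (hb : ∀ j y, |m j y| ≤ 1) {ψ : E3 → ℝ} (hψ : Continuous ψ) (hs : HasCompactSupport ψ)
    (j : Fin 3) :
    Integrable (fun p : E3 × E3 ↦ coulomb 0 j (p.1 - p.2) * m j p.2 * ψ p.1)
      (volume.prod lam) := by
  obtain ⟨C, hC⟩ := hs.exists_bound_of_continuous hψ
  have hψi : Integrable ψ := hψ.integrable_of_hasCompactSupport hs
  have h1 := (integrable_coulombNear_prod (lam := lam) hm hb 1 j).mul_bdd (c := C)
    (g := fun p ↦ ψ p.1) (by fun_prop) (Eventually.of_forall fun p ↦ hC p.1)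
  have h2 := (hψi.comp_fst lam).bdd_mul (c := (1 ^ 2)⁻¹ * 1)
    (f := fun p : E3 × E3 ↦ coulombFar 1 j (p.1 - p.2) * m j p.2)
    (((measurable_coulombFar 1 j).comp (measurable_fst.sub measurable_snd)).mul
      ((hm j).comp measurable_snd)).aestronglyMeasurable
    (Eventually.of_forall fun p ↦ by
      rw [norm_mul]
      exact mul_le_mul (abs_coulombFar_le one_pos j _) (hb j _) (norm_nonneg _) (by positivity))
  refine (h1.add h2).congr (Eventually.of_forall fun p ↦ ?_)
  simp only [Pi.add_apply, ← coulombNear_add_coulombFar 1 j (p.1 - p.2)]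
  ring

/-- The distributional Laplacian of the potential is a multiple of the divergence. -/
theorem integral_potential_mul_laplacian [IsFiniteMeasure lam] (hm : ∀ j, Measurable (m j))
    (hb : ∀ j y, |m j y| ≤ 1) {φ : E3 → ℝ} (hφ : ContDiff ℝ ∞ φ) (hs : HasCompactSupport φ) :
    ∫ x, potential lam m x * laplacian φ x
      = -(coulombFlux * ∫ y, ∑ j, partialDeriv j φ y * m j y ∂lam) := by
  have hint : Integrable (fun p : E3 × E3 ↦ ∑ j, coulomb 0 j (p.1 - p.2) * m j p.2 *
      laplacian φ p.1) (volume.prod lam) :=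
    integrable_finsetSum _ fun j _ ↦ integrable_coulomb_prod hm hb
      (contDiff_laplacian hφ).continuous (hasCompactSupport_laplacian hs) j
  have hloc (j : Fin 3) (y : E3) :
      Integrable fun x ↦ coulomb 0 j (x - y) * m j y * laplacian φ x := by
    have hl := (contDiff_laplacian hφ).continuous
    have h0 : LocallyIntegrable (coulomb 0 j) :=
      locallyIntegrable_inv_norm_sq.mono (measurable_coulomb 0 j).aestronglyMeasurable
        (Eventually.of_forall fun z ↦ by
          rw [Real.norm_of_nonneg (by positivity : 0 ≤ (‖z‖ ^ 2)⁻¹)]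
          exact abs_coulomb_le 0 j z)
    have h1 := h0.integrable_smul_right_of_hasCompactSupport
      (by fun_prop : Continuous fun x : E3 ↦ laplacian φ (x + y))
      ((hasCompactSupport_laplacian hs).comp_homeomorph (Homeomorph.addRight y))
    refine ((h1.comp_sub_right y).const_mul (m j y)).congr (Eventually.of_forall fun x ↦ ?_)
    simp only [sub_add_cancel, smul_eq_mul]
    ring
  calc ∫ x, potential lam m x * laplacian φ x
      = ∫ x, (∫ y, ∑ j, coulomb 0 j (x - y) * m j y * laplacian φ x ∂lam) := by
        simp only [potential, ← Finset.sum_mul, integral_mul_const]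
    _ = ∫ y, (∫ x, ∑ j, coulomb 0 j (x - y) * m j y * laplacian φ x) ∂lam :=
        integral_integral_swap hint
    _ = ∫ y, -coulombFlux * ∑ j, partialDeriv j φ y * m j y ∂lam := by
        refine integral_congr_ae (Eventually.of_forall fun y ↦ ?_)
        simp only
        rw [integral_finsetSum _ fun j _ ↦ hloc j y, Finset.mul_sum]
        refine Finset.sum_congr rfl fun j _ ↦ ?_
        simp only [mul_right_comm _ (m j y), integral_mul_const,
          integral_coulomb_mul_laplacian hφ hs]
        ring
    _ = _ := by rw [integral_const_mul, neg_mul]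

end Potential

/-! ### Divergence and magnetic field as integrals against the densities. -/

section Representation

variable {μ : Fin 3 → SignedMeasure E3} {lam : Measure E3} {m : Fin 3 → E3 → ℝ} {S : Set E3}

theorem sum_totalVariation_compl (hμ : ∀ i, μ i ∈ signedMeasuresOn S) :
    (∑ i, (μ i).totalVariation) Sᶜ = 0 := by
  rw [Measure.finsetSum_apply]
  exact Finset.sum_eq_zero fun i _ ↦
    measure_mono_null (Set.compl_subset_compl.2 (hμ i)) Measure.measure_compl_support

theorem integrable_mul_density [IsFiniteMeasure lam] (hm : ∀ j, Measurable (m j))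
    (hb : ∀ j y, |m j y| ≤ 1) {f : E3 → ℝ} (hf : Integrable f lam) (j : Fin 3) :
    Integrable (fun y ↦ f y * m j y) lam :=
  hf.mul_bdd (c := 1) (hm j).aestronglyMeasurable (Eventually.of_forall (hb j))

theorem distribDiv_eq_integral [IsFiniteMeasure lam] (hm : ∀ j, Measurable (m j))
    (hb : ∀ j y, |m j y| ≤ 1)
    (hrep : ∀ i (f : E3 → ℝ), Integrable f lam → ∫ᵛ y, f y ∂<•(μ i) = ∫ y, f y * m i y ∂lam)
    {φ : E3 → ℝ} (hφ : ContDiff ℝ ∞ φ) (hs : HasCompactSupport φ) :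
    distribDiv μ φ = -∫ y, ∑ j, partialDeriv j φ y * m j y ∂lam := by
  have hi (j : Fin 3) : Integrable (partialDeriv j φ) lam :=
    (contDiff_partialDeriv hφ j).continuous.integrable_of_hasCompactSupport
      (hasCompactSupport_partialDeriv hs j)
  rw [distribDiv, integral_finsetSum _ fun j _ ↦ integrable_mul_density hm hb (hi j) j]
  exact congrArg _ (Finset.sum_congr rfl fun j _ ↦ hrep j _ (hi j))

theorem magneticField_apply_eq_integral [IsFiniteMeasure lam] (hS : IsClosed S)
    (hlam : lam Sᶜ = 0) (hm : ∀ j, Measurable (m j)) (hb : ∀ j y, |m j y| ≤ 1)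
    (hrep : ∀ i (f : E3 → ℝ), Integrable f lam → ∫ᵛ y, f y ∂<•(μ i) = ∫ y, f y * m i y ∂lam)
    {x : E3} (hx : x ∉ S) (i : Fin 3) :
    magneticField μ x i
      = -fieldConst * ∫ y, ∑ j, coulombDeriv 0 i j (x - y) * m j y ∂lam := by
  obtain ⟨r, hr, h⟩ := ae_le_norm_sub hS hlam hx
  have h1 : Integrable (fun y ↦ 1 / ‖x - y‖ ^ 3) lam := by
    refine Integrable.of_bound (Measurable.aestronglyMeasurable (by fun_prop)) (1 / r ^ 3) ?_
    filter_upwards [h] with y hy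
    rw [Real.norm_of_nonneg (by positivity)]
    gcongr
  have h2 (j : Fin 3) : Integrable (fun y ↦ (x - y) i * (x - y) j / ‖x - y‖ ^ 5) lam := by
    have hmx (i : Fin 3) : Measurable fun y : E3 ↦ (x - y) i :=
      (measurable_apply i).comp (measurable_const.sub measurable_id)
    refine Integrable.of_bound (Measurable.aestronglyMeasurable
      (((hmx i).mul (hmx j)).div (by fun_prop))) (1 / r ^ 3) ?_
    filter_upwards [h] with y hy
    have h0 : 0 < ‖x - y‖ := hr.trans_le hy
    rw [norm_div, norm_mul, Real.norm_of_nonneg (by positivity : 0 ≤ ‖x - y‖ ^ 5)]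
    calc ‖(x - y) i‖ * ‖(x - y) j‖ / ‖x - y‖ ^ 5
        ≤ ‖x - y‖ * ‖x - y‖ / ‖x - y‖ ^ 5 := by
          gcongr <;> exact PiLp.norm_apply_le _ _
      _ = 1 / ‖x - y‖ ^ 3 := by field_simp
      _ ≤ 1 / r ^ 3 := by gcongr
  have h3 : ∫ y, ∑ j, coulombDeriv 0 i j (x - y) * m j y ∂lam
      = ∫ y, (1 / ‖x - y‖ ^ 3 * m i y
        - 3 * ∑ j, (x - y) i * (x - y) j / ‖x - y‖ ^ 5 * m j y) ∂lam := by
    refine integral_congr_ae (Eventually.of_forall fun y ↦ ?_)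
    simp only [coulombDeriv, softNorm_zero, sub_mul, Finset.sum_sub_distrib, Finset.mul_sum,
      ite_div, zero_div, ite_mul, zero_mul, Finset.sum_ite_eq, Finset.mem_univ, if_true, mul_assoc]
  rw [h3, integral_sub (integrable_mul_density hm hb h1 i)
    ((integrable_finsetSum _ fun j _ ↦ integrable_mul_density hm hb (h2 j) j).const_mul 3),
    integral_const_mul, integral_finsetSum _ fun j _ ↦ integrable_mul_density hm hb (h2 j) j]
  change -fieldConst * ((∫ᵛ y, 1 / ‖x - y‖ ^ 3 ∂<•(μ i))
      - 3 * ∑ j, ∫ᵛ y, (x - y) i * (x - y) j / ‖x - y‖ ^ 5 ∂<•(μ j)) = _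
  rw [hrep i _ h1, Finset.sum_congr rfl fun j _ ↦ hrep j _ (h2 j)]

end Representation

/-! ### Divergence-free magnetizations are silent. -/

section SilentOfDivergenceFree

/-- The translated Coulomb kernel, smoothly cut off near its singularity `x`. -/
theorem exists_contDiff_eventuallyEq_coulomb (x : E3) (i : Fin 3) {r : ℝ} (hr : 0 < r) :
    ∃ G : E3 → ℝ, ContDiff ℝ ∞ G ∧
      ∀ y, r ≤ ‖x - y‖ → G =ᶠ[𝓝 y] fun y ↦ coulomb 0 i (x - y) := by
  -- The outer radius is strictly below r, so the kernel is unchanged in a whole neighbourhood of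
  -- any y with |x-y| ≥ r, and derivatives there agree too.
  let b : ContDiffBump x := ⟨r / 4, r / 2, by positivity, by linarith⟩
  refine ⟨fun y ↦ (1 - b y) * coulomb 0 i (x - y), contDiff_iff_contDiffAt.2 fun y ↦ ?_,
    fun y hy ↦ ?_⟩
  · rcases eq_or_ne y x with rfl | hne
    · refine (contDiffAt_const (c := (0 : ℝ))).congr_of_eventuallyEq ?_
      filter_upwards [b.eventuallyEq_one] with z hz
      simp [hz]
    · refine (contDiffAt_const.sub b.contDiff.contDiffAt).mul ?_
      exact (contDiffAt_coulomb (ε := 0) i (.inr (sub_ne_zero.2 hne.symm))).comp y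
        (contDiffAt_const.sub contDiffAt_id)
  · have hlt : r / 2 < dist y x := by rw [dist_comm, dist_eq_norm]; linarith
    filter_upwards [(isOpen_lt continuous_const (continuous_id.dist continuous_const)).mem_nhds hlt]
      with z hz
    rw [b.zero_of_le_dist (x := z) (le_of_lt hz), sub_zero, one_mul]

theorem partialDeriv_coulomb_sub (i j : Fin 3) {x y : E3} (h : x - y ≠ 0) :
    partialDeriv j (fun y ↦ coulomb 0 i (x - y)) y = -coulombDeriv 0 i j (x - y) := by
  have hd := (hasFDerivAt_coulomb (ε := 0) i (.inr h)).comp y ((hasFDerivAt_id y).const_sub x)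
  rw [partialDeriv, show (fun y ↦ coulomb 0 i (x - y)) = coulomb 0 i ∘ HSub.hSub x from rfl,
    hd.fderiv]
  simp [sum_apply]

theorem partialDeriv_mul {f g : E3 → ℝ} (hf : ContDiff ℝ ∞ f) (hg : ContDiff ℝ ∞ g) (j : Fin 3)
    (y : E3) :
    partialDeriv j (fun y ↦ f y * g y) y = f y * partialDeriv j g y + partialDeriv j f y * g y := by
  rw [partialDeriv, fderiv_fun_mul (hf.contDiffAt.differentiableAt (by simp))
    (hg.contDiffAt.differentiableAt (by simp))]
  simp [partialDeriv, mul_comm]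

theorem partialDeriv_comp_smul (f : E3 → ℝ) (c : ℝ) (j : Fin 3) (y : E3) :
    partialDeriv j (fun y ↦ f (c • y)) y = c * partialDeriv j f (c • y) := by
  rw [partialDeriv, fderiv_comp_smul]
  rfl

variable {lam : Measure E3} {m : Fin 3 → E3 → ℝ} {S : Set E3}

/-- The function y ↦ Kᵢ(x-y) has the right gradient up to sign, but is singular at x and not
compactly supported. `G` repairs the first defect away from `lam`-almost every y; multiplying by the
wide cutoff `b (c n • y)` repairs the second. The gradient of the cutoff carries a factor `c n` and
disappears in the limit by dominated convergence. -/
theorem integral_coulombDeriv_eq_zero [IsFiniteMeasure lam] (hS : IsClosed S)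
    (hlam : lam Sᶜ = 0) (hm : ∀ j, Measurable (m j)) (hb : ∀ j y, |m j y| ≤ 1)
    (hdiv : ∀ φ : E3 → ℝ, ContDiff ℝ ∞ φ → HasCompactSupport φ →
      ∫ y, ∑ j, partialDeriv j φ y * m j y ∂lam = 0) {x : E3} (hx : x ∉ S) (i : Fin 3) :
    ∫ y, ∑ j, coulombDeriv 0 i j (x - y) * m j y ∂lam = 0 := by
  obtain ⟨r, hr, h⟩ := ae_le_norm_sub hS hlam hx
  obtain ⟨G, hG, hGeq⟩ := exists_contDiff_eventuallyEq_coulomb x i hr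
  let b : ContDiffBump (0 : E3) := ⟨1, 2, one_pos, one_lt_two⟩
  have hbs : ContDiff ℝ ∞ b := b.contDiff
  have hbc (j : Fin 3) : ∃ C, ∀ y, ‖partialDeriv j b y‖ ≤ C :=
    (hasCompactSupport_partialDeriv b.hasCompactSupport j).exists_bound_of_continuous
      (contDiff_partialDeriv hbs j).continuous
  choose C hC using hbc
  let c : ℕ → ℝ := fun n ↦ ((n : ℝ) + 1)⁻¹
  have hc0 (n : ℕ) : 0 < c n := by positivity
  have hc1 (n : ℕ) : c n ≤ 1 := inv_le_one_of_one_le₀ (by simp)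
  have hclim : Tendsto c atTop (𝓝 0) := by
    simpa [c, one_div] using tendsto_one_div_add_atTop_nhds_zero_nat (𝕜 := ℝ)
  have hscale (n : ℕ) : ContDiff ℝ ∞ fun y : E3 ↦ b (c n • y) :=
    hbs.comp (contDiff_const_smul _)
  let φ : ℕ → E3 → ℝ := fun n y ↦ b (c n • y) * G y
  have hφ (n : ℕ) : ContDiff ℝ ∞ (φ n) := (hscale n).mul hG
  have hφs (n : ℕ) : HasCompactSupport (φ n) :=
    (b.hasCompactSupport.comp_smul (hc0 n).ne').mul_right
  have hderiv (n : ℕ) (j : Fin 3) (y : E3) : partialDeriv j (φ n) y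
      = b (c n • y) * partialDeriv j G y + c n * partialDeriv j b (c n • y) * G y := by
    rw [partialDeriv_mul (hscale n) hG, partialDeriv_comp_smul]
  have hGd {y : E3} (hy : r ≤ ‖x - y‖) (j : Fin 3) :
      partialDeriv j G y = -coulombDeriv 0 i j (x - y) := by
    rw [← partialDeriv_coulomb_sub i j (norm_pos_iff.1 (hr.trans_le hy)), partialDeriv,
      (hGeq y hy).fderiv_eq, partialDeriv]
  have hlim : Tendsto (fun n ↦ ∫ y, ∑ j, partialDeriv j (φ n) y * m j y ∂lam) atTop
      (𝓝 (∫ y, ∑ j, -coulombDeriv 0 i j (x - y) * m j y ∂lam)) := by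
    refine tendsto_integral_of_dominated_convergence
      (fun _ ↦ ∑ j, (1 * (4 / r ^ 3) + 1 * C j * (r ^ 2)⁻¹) * 1) (fun n ↦ ?_)
      (integrable_const _) (fun n ↦ ?_) ?_
    · exact (Finset.measurable_fun_sum _ fun j _ ↦
        (contDiff_partialDeriv (hφ n) j).continuous.measurable.mul (hm j)).aestronglyMeasurable
    · filter_upwards [h] with y hy
      refine norm_sum_le_of_le _ fun j _ ↦ ?_
      have hCj : 0 ≤ C j := (norm_nonneg _).trans (hC j 0)
      rw [norm_mul]
      refine mul_le_mul ?_ (hb j y) (norm_nonneg _) (by positivity)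
      rw [hderiv]
      refine norm_add_le_of_le ?_ ?_
      · rw [norm_mul, hGd hy, norm_neg, Real.norm_of_nonneg b.nonneg]
        exact mul_le_mul b.le_one (abs_coulombDeriv_le i j hr hy) (norm_nonneg _) zero_le_one
      · rw [norm_mul, norm_mul, Real.norm_of_nonneg (hc0 n).le, (hGeq y hy).self_of_nhds]
        gcongr
        · exact hc1 n
        · exact hC j _
        · exact abs_coulomb_le_of_le i hr hy
    · filter_upwards [h] with y hy
      refine tendsto_finsetSum _ fun j _ ↦ Tendsto.mul_const _ ?_
      simp only [hderiv, hGd hy]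
      have hy0 : Tendsto (fun n ↦ c n • y) atTop (𝓝 0) := by
        simpa using hclim.smul_const y
      have hb1 : Tendsto (fun n ↦ b (c n • y)) atTop (𝓝 1) := by
        have := (b.continuous.tendsto 0).comp hy0
        rwa [b.eventuallyEq_one.self_of_nhds] at this
      have hd1 := ((contDiff_partialDeriv hbs j).continuous.tendsto 0).comp hy0
      simpa using (hb1.mul_const (-coulombDeriv 0 i j (x - y))).add
        ((hclim.mul hd1).mul_const (G y))
  have h0 := tendsto_nhds_unique hlim
    (tendsto_const_nhds.congr fun n ↦ (hdiv (φ n) (hφ n) (hφs n)).symm)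
  simpa only [neg_mul, Finset.sum_neg_distrib, integral_neg, neg_eq_zero] using h0

end SilentOfDivergenceFree

/-! ### Silent magnetizations on slender sets are divergence-free. -/

section DivergenceFreeOfSilent

variable {lam : Measure E3} {m : Fin 3 → E3 → ℝ} {S : Set E3}

/-- Off a slender set, a potential whose gradient vanishes must vanish. -/
theorem potential_eq_zero [IsFiniteMeasure lam] (hS : IsSlender S) (hlam : lam Sᶜ = 0)
    (hm : ∀ j, Measurable (m j)) (hb : ∀ j y, |m j y| ≤ 1)
    (hfield : ∀ x ∉ S, ∀ i, ∫ y, ∑ j, coulombDeriv 0 i j (x - y) * m j y ∂lam = 0) {x : E3}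
    (hx : x ∉ S) : potential lam m x = 0 := by
  have hd (z : E3) (hz : z ∈ connectedComponentIn Sᶜ x) :
      HasFDerivAt (potential lam m) (0 : E3 →L[ℝ] ℝ) z := by
    have hzS : z ∈ Sᶜ := connectedComponentIn_subset _ _ hz
    refine (hasFDerivAt_potential hS.isClosed hlam hm hb hzS).congr_fderiv ?_
    simp [hfield z hzS]
  have hdiff : DifferentiableOn ℝ (potential lam m) (connectedComponentIn Sᶜ x) :=
    fun z hz ↦ (hd z hz).differentiableAt.differentiableWithinAt
  have hfd : (connectedComponentIn Sᶜ x).EqOn (fderiv ℝ (potential lam m)) 0 :=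
    fun z hz ↦ (hd z hz).fderiv
  obtain ⟨a, ha⟩ := hS.isClosed.isOpen_compl.connectedComponentIn.exists_is_const_of_fderiv_eq_zero
    (𝕜 := ℝ) (f := potential lam m) isPreconnected_connectedComponentIn
    hdiff hfd
  rw [ha x (mem_connectedComponentIn hx)]
  exact potential_eq_zero_of_const hS.isClosed hlam hm hb (connectedComponentIn_subset _ _)
    (hS.volume_component x hx) ha

/-- Since S is null, the potential vanishes almost everywhere, and hence so does its distributional
Laplacian, a nonzero multiple of the divergence. -/
theorem integral_partialDeriv_eq_zero [IsFiniteMeasure lam] (hS : IsSlender S)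
    (hlam : lam Sᶜ = 0) (hm : ∀ j, Measurable (m j)) (hb : ∀ j y, |m j y| ≤ 1)
    (hfield : ∀ x ∉ S, ∀ i, ∫ y, ∑ j, coulombDeriv 0 i j (x - y) * m j y ∂lam = 0)
    {φ : E3 → ℝ} (hφ : ContDiff ℝ ∞ φ) (hs : HasCompactSupport φ) :
    ∫ y, ∑ j, partialDeriv j φ y * m j y ∂lam = 0 := by
  have h := integral_potential_mul_laplacian (lam := lam) hm hb hφ hs
  have hnull : ∀ᵐ x, x ∉ S := measure_eq_zero_iff_ae_notMem.1 hS.volume_eq_zero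
  rw [integral_eq_zero_of_ae (hnull.mono fun x hx ↦ by
    simp [potential_eq_zero hS hlam hm hb hfield hx]), eq_comm, neg_eq_zero] at h
  exact (mul_eq_zero.1 h).resolve_left coulombFlux_pos.ne'

end DivergenceFreeOfSilent

end Magnetization

end

/-! ### Both implications, translated back from densities to measures. -/

theorem mainTheorem4 (S : Set Magnetization.E3) (hS : IsClosed S)
    (μ : Fin 3 → SignedMeasure Magnetization.E3)
    (hμ : ∀ i, μ i ∈ Magnetization.signedMeasuresOn S) :
    (Magnetization.IsDivergenceFree μ → Magnetization.IsSilent S μ) ∧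
    (Magnetization.IsSlender S → Magnetization.IsSilent S μ → Magnetization.IsDivergenceFree μ) := by
  open Magnetization in
  obtain ⟨m, hm, hb, hrep⟩ := exists_bounded_density μ
  have hlam := sum_totalVariation_compl hμ
  have hfin (i : Fin 3) : IsFiniteMeasure (μ i).totalVariation := by
    rw [SignedMeasure.totalVariation]; infer_instance
  have hfield {x : E3} (hx : x ∉ S) (i : Fin 3) :=
    magneticField_apply_eq_integral hS hlam hm hb hrep hx i
  have hdiv {φ : E3 → ℝ} (hφ : ContDiff ℝ ∞ φ) (hs : HasCompactSupport φ) :=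
    distribDiv_eq_integral hm hb hrep hφ hs
  constructor
  · intro hfree
    rw [isSilent_iff]
    intro x hx
    ext i
    rw [hfield hx, integral_coulombDeriv_eq_zero hS hlam hm hb (fun φ hφ hs ↦ ?_) hx i]
    · simp
    · rw [← neg_eq_zero, ← hdiv hφ hs, hfree φ hφ hs]
  · intro hslender hsilent φ hφ hs
    rw [isSilent_iff] at hsilent
    rw [hdiv hφ hs, integral_partialDeriv_eq_zero hslender hlam hm hb (fun x hx i ↦ ?_) hφ hs,
      neg_zero]
    have h := hfield hx i
    rw [hsilent x hx] at h
    exact (mul_eq_zero.1 h.symm).resolve_left (by norm_num [fieldConst])
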